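/- Let $N\ge 9$ be an odd integer. For a real $2\times N$ matrix $A$, let $\kappa_3(A)=\max_{S}\kappa(A_S)$, where $S$ ranges over the $3$-element subsets of $\{1,\dots,N\}$, $A_S$ is the $2\times 3$ submatrix of $A$ formed by the columns indexed by $S$, and $\kappa(B)=\sigma_{\max}(B)/\sigma_{\min}(B)$ is the ratio of the largest to the smallest singular value ($\kappa(B)=\infty$ if $B\neq 0$ and $\sigma_{\min}(B)=0$). Call $A$ optimal if its columns have Euclidean norm $1$ and $\kappa_3(A)\le\kappa_3(B)$ for every real $2\times N$ matrix $B$ with columns of Euclidean norm $1$. For $\theta=(\theta_1,\dots,\theta_N)$ let $A(\theta)$ be the matrix with columns $(\cos\theta_i,\sin\theta_i)^T$, $1\le i\le N$. (1) If $\theta_i=\frac{2\pi(i-1)}{N+1} \bmod \pi$ for $1\le i\le N$, then $A(\theta)$ is optimal. (2) Let $\theta_1,\dots,\theta_N\in[0,\pi)$ be arbitrary, arrange the doubled angles $2\theta_i$ on the circle in counter-clockwise order, and consider the $N$ arcs between cyclically consecutive ones (of total length $2\pi$). Then $A(\theta)$ is optimal if and only if, starting from a suitable arc and going once around the circle, the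 arcs have lengths $\alpha,\beta,\alpha,\beta,\dots,\alpha,\beta,\alpha$ with $\alpha=\frac{4\pi}{N+1}$ and $\beta=0$. -/

import Mathlib

open scoped ENNReal

noncomputable section

namespace Sensing

/-- The condition number `σ_max(B) / σ_min(B)` of a nonzero real `m × n` matrix `B`, with value `∞`
when the smallest singular value vanishes. The singular values `σ_0 ≥ σ_1 ≥ …` of `B` are those of
the linear map `x ↦ Bᵀ x` between Euclidean spaces; `σ_0` is the largest one and the one with index
`min m n - 1` is the smallest one. -/
def condNumber {m n : Type*} [Fintype m] [Fintype n] [DecidableEq m] [DecidableEq n]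
    (B : Matrix m n ℝ) : ℝ≥0∞ :=
  ENNReal.ofReal ((Matrix.toEuclideanLin B.transpose).singularValues 0) /
    ENNReal.ofReal ((Matrix.toEuclideanLin B.transpose).singularValues
      (min (Fintype.card m) (Fintype.card n) - 1))

/-- The submatrix of `A` formed by the columns with index in `S`. -/
def columnSubmatrix {M N : ℕ} (A : Matrix (Fin M) (Fin N) ℝ) (S : Finset (Fin N)) :
    Matrix (Fin M) {j : Fin N // j ∈ S} ℝ :=
  A.submatrix id Subtype.val

/-- The maximum condition number among all submatrices of `A` with `K` columns. -/
def maxCondNumber {M N : ℕ} (K : ℕ) (A : Matrix (Fin M) (Fin N) ℝ) : ℝ≥0∞ :=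
  ⨆ S ∈ (Finset.univ : Finset (Fin N)).powersetCard K, condNumber (columnSubmatrix A S)

/-- Every column of `A` has Euclidean norm one. -/
def UnitColumns {M N : ℕ} (A : Matrix (Fin M) (Fin N) ℝ) : Prop :=
  ∀ j : Fin N, ‖WithLp.toLp 2 (fun i : Fin M => A i j)‖ = 1

/-- `A` is an optimal sensing matrix for `(M, N, K)`: it has unit-norm columns and minimizes the
maximum condition number of the `K`-column submatrices among all `M × N` matrices with unit-norm
columns. -/
def IsOptimalMatrix {M N : ℕ} (K : ℕ) (A : Matrix (Fin M) (Fin N) ℝ) : Prop :=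
  UnitColumns A ∧
    ∀ B : Matrix (Fin M) (Fin N) ℝ, UnitColumns B → maxCondNumber K A ≤ maxCondNumber K B

/-- The `2 × N` matrix with columns `(cos θ_i, sin θ_i)`. -/
def angleMatrix {N : ℕ} (θ : Fin N → ℝ) : Matrix (Fin 2) (Fin N) ℝ :=
  Matrix.of ![fun i => Real.cos (θ i), fun i => Real.sin (θ i)]

/-- The angles `θ_i = 2π(i-1)/(N+1) mod π`, `1 ≤ i ≤ N`, with representatives in `[0, π)`; the index
here starts at `0`. -/
def optimalAngles (N : ℕ) (i : Fin N) : ℝ :=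
  toIcoMod Real.pi_pos 0 (2 * Real.pi * (i : ℝ) / ((N : ℝ) + 1))

/-- The doubled angles `2θ_i`, arranged in nondecreasing order. For `θ_i ∈ [0, π)` these are points
of `[0, 2π)` listed counter-clockwise on the circle. -/
def sortedDoubled {N : ℕ} (θ : Fin N → ℝ) (i : Fin N) : ℝ :=
  2 * θ (Tuple.sort θ i)

/-- The `i`-th arc: the counter-clockwise region from the `i`-th doubled angle to the next one, where
the last doubled angle is followed by the first one (after a full turn). -/
def arc {N : ℕ} (θ : Fin N → ℝ) (i : Fin N) : ℝ :=
  sortedDoubled θ (finRotate N i) - sortedDoubled θ i +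
    if (i : ℕ) + 1 = N then 2 * Real.pi else 0

/-- Starting from a suitable one and going once around the circle, the `N` arcs are
`α, β, α, β, …`. (Indices are added modulo `N`.) -/
def ArcsAlternate {N : ℕ} (θ : Fin N → ℝ) (α β : ℝ) : Prop :=
  ∃ j : Fin N, ∀ k : Fin N, arc θ (j + k) = if Even (k : ℕ) then α else β

end Sensing

end

namespace Sensing

/-! For three unit vectors in the plane the squared singular values have sum 3 and product (3 -
G)/2, where G is the sum of the cosines of the differences of the doubled angles. The condition
number therefore increases with G, and the task is to minimise the largest G over all triples. Write
N = 2n - 1 with n ≥ 5 and α = 2π/n. The extremal value is 1 + 2 cos α.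

Upper bound: if the doubled angles lie on a regular n-gon, at most two at each vertex, any triple
has at most one coincident pair, so its other two cosines are at most cos α
(`triplesLE_of_lattice`).

Rigidity: consecutive points with gaps a, b ≤ m and G ≤ 1 + 2 cos α satisfy (n - 1)(a + b) + m ≥ nα,
with equality only for gaps {α, 0} (`gap_pair`, by concavity of cosine). Set a largest gap m aside
and pair the other 2(n - 1) gaps. Adding the n - 1 inequalities gives exactly the total length 2π =
nα, so all of them are equalities. Parity then forces the alternating pattern
(`alternating_of_gaps`). Since that pattern attains the bound, no configuration stays strictly below
it. -/

/-! ### Condition numbers of triples as a function of cosine sums. -/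

/-- The sum of the cosines of the pairwise differences of three doubled angles. -/
noncomputable def tripleCos {N : ℕ} (θ : Fin N → ℝ) (a b c : Fin N) : ℝ :=
  Real.cos (2 * θ a - 2 * θ b) + Real.cos (2 * θ b - 2 * θ c) + Real.cos (2 * θ a - 2 * θ c)

/-- The condition number of a triple of unit vectors in the plane, as a function of `tripleCos`. -/
noncomputable def tripleCond (G : ℝ) : ℝ≥0∞ :=
  ENNReal.ofReal √((3 + √(3 + 2 * G)) / 2) / ENNReal.ofReal √((3 - √(3 + 2 * G)) / 2)

lemma tripleCond_mono : Monotone tripleCond := by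
  intro G H h
  unfold tripleCond
  gcongr

lemma tripleCond_lt {G H : ℝ} (hG : -3 / 2 ≤ G) (hG3 : G < 3) (h : G < H) :
    tripleCond G < tripleCond H := by
  have h1 : √(3 + 2 * G) < √(3 + 2 * H) := Real.sqrt_lt_sqrt (by linarith) (by linarith)
  have h2 : √(3 + 2 * G) < 3 := by
    rw [Real.sqrt_lt' (by norm_num)]; linarith
  have h0 := Real.sqrt_nonneg (3 + 2 * G)
  have hB : 0 < √((3 - √(3 + 2 * G)) / 2) := Real.sqrt_pos.2 (by linarith)
  have hA : √((3 + √(3 + 2 * G)) / 2) < √((3 + √(3 + 2 * H)) / 2) :=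
    Real.sqrt_lt_sqrt (by linarith) (by linarith)
  unfold tripleCond
  -- Strictness comes from the numerator: the denominator for `H` may vanish, whereas the one for
  -- `G` is positive and finite.
  calc _ < ENNReal.ofReal √((3 + √(3 + 2 * H)) / 2) / ENNReal.ofReal √((3 - √(3 + 2 * G)) / 2) := by
        apply ENNReal.div_lt_div_right
        · simpa using hB
        · exact ENNReal.ofReal_ne_top
        · exact (ENNReal.ofReal_lt_ofReal_iff (hA.trans_le' (Real.sqrt_nonneg _))).2 hA
    _ ≤ _ := by gcongr

section Singular

variable {n : Type*} [Fintype n] [DecidableEq n]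

/-- Because of the transpose, the Gram operator acts on the plane, so the trace and determinant of a
2 × 2 matrix determine both singular values. -/
lemma adjoint_comp_toEuclideanLin_transpose (B : Matrix (Fin 2) n ℝ) :
    LinearMap.adjoint (Matrix.toEuclideanLin B.transpose) ∘ₗ Matrix.toEuclideanLin B.transpose =
      Matrix.toEuclideanLin (B * B.transpose) := by
  rw [← Matrix.toEuclideanLin_conjTranspose_eq_adjoint]
  have hB : B.transpose.conjTranspose = B := by
    ext i j
    simp
  rw [hB]
  ext x
  simp [Matrix.toLpLin_apply]

lemma sq_singularValues_add (B : Matrix (Fin 2) n ℝ) :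
    (Matrix.toEuclideanLin B.transpose).singularValues 0 ^ 2 +
      (Matrix.toEuclideanLin B.transpose).singularValues 1 ^ 2 = (B * B.transpose).trace := by
  have hn : Module.finrank ℝ (EuclideanSpace ℝ (Fin 2)) = 2 := by simp
  have h := (Matrix.toEuclideanLin B.transpose).isSymmetric_adjoint_comp_self.trace_eq_sum_eigenvalues
    hn
  rw [Fin.sum_univ_two] at h
  have h0 := (Matrix.toEuclideanLin B.transpose).sq_singularValues_fin hn 0
  have h1 := (Matrix.toEuclideanLin B.transpose).sq_singularValues_fin hn 1
  simp only [Fin.val_zero, Fin.val_one] at h0 h1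
  rw [h0, h1]
  simp only [RCLike.ofReal_real_eq_id, id] at h
  rw [← h, adjoint_comp_toEuclideanLin_transpose, Matrix.toEuclideanLin, Matrix.toLpLin_eq_toLin,
    LinearMap.trace_eq_matrix_trace ℝ (PiLp.basisFun 2 ℝ (Fin 2)), LinearMap.toMatrix_toLin]

lemma sq_singularValues_mul (B : Matrix (Fin 2) n ℝ) :
    (Matrix.toEuclideanLin B.transpose).singularValues 0 ^ 2 *
      (Matrix.toEuclideanLin B.transpose).singularValues 1 ^ 2 = (B * B.transpose).det := by
  have hn : Module.finrank ℝ (EuclideanSpace ℝ (Fin 2)) = 2 := by simp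
  have h := (Matrix.toEuclideanLin B.transpose).isSymmetric_adjoint_comp_self.det_eq_prod_eigenvalues
    hn
  rw [Fin.prod_univ_two] at h
  have h0 := (Matrix.toEuclideanLin B.transpose).sq_singularValues_fin hn 0
  have h1 := (Matrix.toEuclideanLin B.transpose).sq_singularValues_fin hn 1
  simp only [Fin.val_zero, Fin.val_one] at h0 h1
  rw [h0, h1]
  simp only [RCLike.ofReal_real_eq_id, id] at h
  rw [← h, adjoint_comp_toEuclideanLin_transpose, Matrix.toEuclideanLin, Matrix.toLpLin_eq_toLin,
    LinearMap.det_toLin]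

/-- Nonnegative numbers `s ≥ t` with `s² + t² = 3` are determined by `s t`. -/
lemma eq_sqrt_of_sq_add_sq {s t G : ℝ} (ht : 0 ≤ t) (hst : t ≤ s) (hadd : s ^ 2 + t ^ 2 = 3)
    (hmul : s ^ 2 * t ^ 2 = (3 - G) / 2) :
    s = √((3 + √(3 + 2 * G)) / 2) ∧ t = √((3 - √(3 + 2 * G)) / 2) := by
  have h : √(3 + 2 * G) = s ^ 2 - t ^ 2 := by
    have : 3 + 2 * G = (s ^ 2 - t ^ 2) ^ 2 := by
      have : (s ^ 2 - t ^ 2) ^ 2 = (s ^ 2 + t ^ 2) ^ 2 - 4 * (s ^ 2 * t ^ 2) := by ring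
      rw [this, hadd, hmul]; ring
    rw [this, Real.sqrt_sq]
    nlinarith
  rw [h]
  constructor
  · rw [show (3 + (s ^ 2 - t ^ 2)) / 2 = s ^ 2 by linarith, Real.sqrt_sq (ht.trans hst)]
  · rw [show (3 - (s ^ 2 - t ^ 2)) / 2 = t ^ 2 by linarith, Real.sqrt_sq ht]

end Singular

lemma condNumber_angleMatrix {N : ℕ} (θ : Fin N → ℝ) {a b c : Fin N} (hab : a ≠ b) (hac : a ≠ c)
    (hbc : b ≠ c) :
    condNumber (columnSubmatrix (angleMatrix θ) {a, b, c}) = tripleCond (tripleCos θ a b c) := by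
  set B := columnSubmatrix (angleMatrix θ) {a, b, c} with hB
  have hsum : ∀ f : Fin N → ℝ, ∑ x : {j // j ∈ ({a, b, c} : Finset (Fin N))}, f x =
      f a + f b + f c := by
    intro f
    rw [Finset.sum_coe_sort ({a, b, c} : Finset (Fin N)) f, Finset.sum_insert (by simp [hab, hac]),
      Finset.sum_pair hbc]
    ring
  have hent : ∀ i j, (B * B.transpose) i j = angleMatrix θ i a * angleMatrix θ j a +
      angleMatrix θ i b * angleMatrix θ j b + angleMatrix θ i c * angleMatrix θ j c := by
    intro i j
    rw [Matrix.mul_apply]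
    exact hsum (fun x => angleMatrix θ i x * angleMatrix θ j x)
  have ha := Real.sin_sq_add_cos_sq (θ a)
  have hb := Real.sin_sq_add_cos_sq (θ b)
  have hc := Real.sin_sq_add_cos_sq (θ c)
  have htr : (B * B.transpose).trace = 3 := by
    rw [Matrix.trace_fin_two, hent, hent]
    simp only [angleMatrix, Matrix.of_apply, Matrix.cons_val_zero, Matrix.cons_val_one]
    linarith
  -- The bracket is a 2 × 2 minor of the matrix; by Cauchy–Binet the determinant of `B *
  -- B.transpose` is the sum of the squares of these minors.
  have hcos : ∀ x y : Fin N, Real.cos (2 * θ x - 2 * θ y) = 1 - 2 * (Real.cos (θ x) *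
      Real.sin (θ y) - Real.sin (θ x) * Real.cos (θ y)) ^ 2 := by
    intro x y
    have : 2 * θ x - 2 * θ y = 2 * (θ x - θ y) := by ring
    rw [this, Real.cos_two_mul', Real.cos_sub, Real.sin_sub]
    have hx := Real.sin_sq_add_cos_sq (θ x)
    have hy := Real.sin_sq_add_cos_sq (θ y)
    linear_combination (Real.sin (θ y) ^ 2 + Real.cos (θ y) ^ 2) * hx + hy
  have hdet : (B * B.transpose).det = (3 - tripleCos θ a b c) / 2 := by
    rw [Matrix.det_fin_two, hent, hent, hent, hent, tripleCos, hcos, hcos, hcos]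
    simp only [angleMatrix, Matrix.of_apply, Matrix.cons_val_zero, Matrix.cons_val_one]
    ring
  have hcard : min (Fintype.card (Fin 2)) (Fintype.card {j // j ∈ ({a, b, c} : Finset (Fin N))}) - 1
      = 1 := by
    rw [Fintype.card_coe, Finset.card_eq_three.2 ⟨a, b, c, hab, hac, hbc, rfl⟩]
    rfl
  obtain ⟨h0, h1⟩ := eq_sqrt_of_sq_add_sq
    ((Matrix.toEuclideanLin B.transpose).singularValues_nonneg 1)
    ((Matrix.toEuclideanLin B.transpose).singularValues_antitone zero_le_one)
    ((sq_singularValues_add B).trans htr) ((sq_singularValues_mul B).trans hdet)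
  rw [condNumber, hcard, h0, h1, tripleCond]

/-- Every triple of distinct indices has `tripleCos` at most `c`. -/
def TriplesLE {N : ℕ} (θ : Fin N → ℝ) (c : ℝ) : Prop :=
  ∀ i j k : Fin N, i ≠ j → i ≠ k → j ≠ k → tripleCos θ i j k ≤ c

lemma maxCondNumber_le_iff {N : ℕ} (θ : Fin N → ℝ) {c : ℝ} (hc : -3 / 2 ≤ c) (hc3 : c < 3) :
    maxCondNumber 3 (angleMatrix θ) ≤ tripleCond c ↔ TriplesLE θ c := by
  simp only [maxCondNumber, iSup_le_iff, Finset.mem_powersetCard, Finset.subset_univ, true_and]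
  constructor
  · intro h i j k hij hik hjk
    have := h {i, j, k} (Finset.card_eq_three.2 ⟨i, j, k, hij, hik, hjk, rfl⟩)
    rw [condNumber_angleMatrix θ hij hik hjk] at this
    by_contra! hlt
    exact absurd this (not_le.2 (tripleCond_lt hc hc3 hlt))
  · intro h S hS
    obtain ⟨i, j, k, hij, hik, hjk, rfl⟩ := Finset.card_eq_three.1 hS
    rw [condNumber_angleMatrix θ hij hik hjk]
    exact tripleCond_mono (h i j k hij hik hjk)

lemma tripleCond_le_maxCondNumber {N : ℕ} (θ : Fin N → ℝ) {a b c : Fin N} (hab : a ≠ b)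
    (hac : a ≠ c) (hbc : b ≠ c) :
    tripleCond (tripleCos θ a b c) ≤ maxCondNumber 3 (angleMatrix θ) := by
  rw [← condNumber_angleMatrix θ hab hac hbc]
  exact le_iSup₂_of_le {a, b, c} (by simp [Finset.card_eq_three.2 ⟨a, b, c, hab, hac, hbc, rfl⟩])
    le_rfl

lemma unitColumns_angleMatrix {N : ℕ} (θ : Fin N → ℝ) : UnitColumns (angleMatrix θ) := by
  intro j
  simp [angleMatrix, EuclideanSpace.norm_eq, Fin.sum_univ_two]

lemma UnitColumns.exists_eq_angleMatrix {N : ℕ} {B : Matrix (Fin 2) (Fin N) ℝ}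
    (hB : UnitColumns B) : ∃ θ, B = angleMatrix θ := by
  have : ∀ j, ∃ t : ℝ, B 0 j = Real.cos t ∧ B 1 j = Real.sin t := by
    intro j
    have h := hB j
    simp only [EuclideanSpace.norm_eq, Fin.sum_univ_two, Real.norm_eq_abs, sq_abs,
      Real.sqrt_eq_one] at h
    have hz : ‖(⟨B 0 j, B 1 j⟩ : ℂ)‖ = 1 := by
      rw [Complex.norm_def, Complex.normSq_mk, Real.sqrt_eq_one]; linarith
    have h1 := Complex.norm_mul_cos_arg (⟨B 0 j, B 1 j⟩ : ℂ)
    have h2 := Complex.norm_mul_sin_arg (⟨B 0 j, B 1 j⟩ : ℂ)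
    rw [hz, one_mul] at h1 h2
    exact ⟨_, h1.symm, h2.symm⟩
  choose θ h0 h1 using this
  refine ⟨θ, ?_⟩
  ext i j
  fin_cases i
  · simpa [angleMatrix] using h0 j
  · simpa [angleMatrix] using h1 j

/-! ### The cosine inequality for two consecutive gaps. -/

/-- Comparison of three equally spaced points with the extremal triple. -/
lemma cos_spread_lt {t α : ℝ} (ht : 0 < t) (ht2 : t ≤ 2 * Real.pi / 9) (hα : 9 / 5 * t ≤ α)
    (hα2 : α ≤ Real.pi) : 1 + 2 * Real.cos α < 2 * Real.cos t + Real.cos (2 * t) := by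
  have hpi := Real.pi_lt_d2
  have ht7 : t < 7 / 10 := by linarith
  -- To second order the claim is 3t² < α², which holds because (9/5)² > 3; the Taylor bounds below
  -- control the remainder.
  have h1 : Real.cos α ≤ Real.cos (2 * (9 / 10 * t)) :=
    Real.cos_le_cos_of_nonneg_of_le_pi (by linarith) hα2 (by linarith)
  rw [Real.cos_two_mul] at h1
  rw [Real.cos_two_mul]
  have hC : 1 - t ^ 2 / 2 ≤ Real.cos t := Real.one_sub_sq_div_two_le_cos
  have hD := (abs_le.1 (Real.cos_bound (x := 9 / 10 * t)
    (by rw [abs_of_nonneg (by linarith)]; linarith))).2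
  rw [abs_of_nonneg (by linarith)] at hD
  have hD0 : 0 ≤ Real.cos (9 / 10 * t) :=
    Real.cos_nonneg_of_neg_pi_div_two_le_of_le (by linarith [Real.pi_pos])
      (by linarith [Real.pi_gt_three])
  set C := Real.cos t
  set D := Real.cos (9 / 10 * t)
  set q := t ^ 2 with hq
  have hq0 : 0 < q := by positivity
  have hq1 : q < 1 / 2 := by nlinarith
  -- The quartic coefficient (9/10)⁴ · 5/96 from `Real.cos_bound` is rounded up to 175/5000.
  have hD' : D ≤ 1 - 81 / 200 * q + 175 / 5000 * q ^ 2 := by nlinarith [sq_nonneg q]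
  have hDD : D ^ 2 ≤ (1 - 81 / 200 * q + 175 / 5000 * q ^ 2) ^ 2 := by gcongr
  have hCC : (1 - q / 2) ^ 2 ≤ C ^ 2 := by
    gcongr
    linarith
  have key : 2 * (1 - 81 / 200 * q + 175 / 5000 * q ^ 2) ^ 2 < (1 - q / 2) + (1 - q / 2) ^ 2 := by
    have e : (1 - q / 2) + (1 - q / 2) ^ 2 - 2 * (1 - 81 / 200 * q + 175 / 5000 * q ^ 2) ^ 2 =
      q * (3 / 25 + (1 / 4 - 7 / 50 - 2 * (81 / 200) ^ 2) * q + 4 * (81 / 200) * (175 / 5000) * q ^ 2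
        - 2 * (175 / 5000) ^ 2 * q ^ 3) := by ring
    have : 0 < 3 / 25 + (1 / 4 - 7 / 50 - 2 * (81 / 200) ^ 2) * q
        + 4 * (81 / 200) * (175 / 5000) * q ^ 2 - 2 * (175 / 5000) ^ 2 * q ^ 3 := by
      nlinarith [mul_pos hq0 hq0, pow_pos hq0 3]
    nlinarith [mul_pos hq0 this]
  linarith

/-- Two consecutive gaps `b ≤ a` with `cos a + cos b + cos (a + b) ≤ 1 + 2 cos α` cannot be small. -/
lemma gap_pair_of_le {n : ℕ} (hn : 5 ≤ n) {α a b : ℝ} (hα : n * α = 2 * Real.pi) (hb : 0 ≤ b)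
    (hba : b ≤ a) (hg : Real.cos a + Real.cos b + Real.cos (a + b) ≤ 1 + 2 * Real.cos α)
    (hle : n * a + (n - 1) * b ≤ n * α) : a = α ∧ b = 0 := by
  have hn' : (5 : ℝ) ≤ n := by exact_mod_cast hn
  have hpi := Real.pi_pos
  set u : ℝ := (n : ℝ) with hu
  have hα0 : 0 < α := by
    by_contra! h
    nlinarith
  have hα5 : α ≤ 2 * Real.pi / 5 := by nlinarith
  -- For fixed `b`, `a'` is the largest gap allowed by `hle`; enlarging `a` to `a'` only lowers the
  -- cosines.
  set a' := α - (u - 1) * b / u with ha'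
  have hu0 : 0 < u := by linarith
  have haa' : a ≤ a' := by
    rw [ha', le_sub_iff_add_le, ← sub_nonneg]
    have : 0 ≤ (u * α - (u * a + (u - 1) * b)) / u := div_nonneg (by linarith) hu0.le
    have e : (u * α - (u * a + (u - 1) * b)) / u = α - (a + (u - 1) * b / u) := by
      field_simp
    linarith
  have hab' : a' + b = α + b / u := by
    rw [ha']; field_simp; ring
  -- The line n a + (n - 1) b = n α meets the diagonal at (t, t), so t = 2π/(2n - 1) is the gap of
  -- equally spaced points.
  set t := u * α / (2 * u - 1) with ht
  have h2u : 0 < 2 * u - 1 := by linarith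
  have ht' : t * (2 * u - 1) = u * α := by rw [ht, div_mul_cancel₀ _ h2u.ne']
  have ht0 : 0 < t := by positivity
  have hbt : b ≤ t := by
    rw [ht, le_div_iff₀ h2u]
    nlinarith
  have ht9 : t ≤ 2 * Real.pi / 9 := by nlinarith
  have hαt : 9 / 5 * t ≤ α := by nlinarith
  have hαt2 : α ≤ 2 * t := by nlinarith
  have hlt := cos_spread_lt ht0 ht9 hαt (by linarith)
  have hbu : b / u ≤ b := div_le_self hb (by linarith)
  have hbu0 : 0 ≤ b / u := by positivity
  have hbt' : b / u ≤ t / u := by gcongr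
  have e2t : α + t / u = 2 * t := by
    field_simp; nlinarith
  have ea't : α - (u - 1) * t / u = t := by
    field_simp; nlinarith
  have ha0 : 0 ≤ a := hb.trans hba
  have hca : Real.cos a' ≤ Real.cos a :=
    Real.cos_le_cos_of_nonneg_of_le_pi ha0 (by linarith) haa'
  have hcab : Real.cos (a' + b) ≤ Real.cos (a + b) :=
    Real.cos_le_cos_of_nonneg_of_le_pi (by linarith) (by linarith) (by linarith)
  rcases hb.eq_or_lt with hb0 | hb0
  · subst hb0
    refine ⟨?_, rfl⟩
    simp only [add_zero, Real.cos_zero] at hg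
    by_contra hne
    have : a < α := lt_of_le_of_ne (by simpa [ha'] using haa') hne
    have := Real.cos_lt_cos_of_nonneg_of_le_pi ha0 (by linarith) this
    linarith
  · exfalso
    -- The point (a', b) divides the segment from (α, 0) to (t, t) in ratio l. The cosine sum is
    -- concave there, equals 1 + 2 cos α at the first end and exceeds it at the second, so `b > 0`
    -- contradicts `hg`.
    have hconc := strictConcaveOn_cos_Icc.concaveOn
    set l := b / t with hl
    have hl0 : 0 < l := by positivity
    have hl1 : l ≤ 1 := (div_le_one ht0).2 hbt
    have hlt' : l * t = b := by rw [hl]; field_simp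
    have seg : ∀ x y : ℝ, 0 ≤ x → x ≤ Real.pi / 2 → 0 ≤ y → y ≤ Real.pi / 2 →
        (1 - l) * Real.cos x + l * Real.cos y ≤ Real.cos ((1 - l) * x + l * y) := by
      intro x y hx hx' hy hy'
      exact hconc.2 ⟨by linarith, hx'⟩ ⟨by linarith, hy'⟩ (by linarith) hl0.le (by ring)
    have s1 := seg α t hα0.le (by linarith) ht0.le (by linarith)
    have s2 := seg 0 t le_rfl (by linarith) ht0.le (by linarith)
    have s3 := seg α (2 * t) hα0.le (by linarith) (by linarith) (by linarith)
    have e1 : (1 - l) * α + l * t = a' := by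
      rw [ha', ← hlt', ← sub_eq_zero]
      have : (1 - l) * α + l * t - (α - (u - 1) * (l * t) / u) =
        l * (t - (α - (u - 1) * t / u)) := by ring
      rw [this, ea't]; ring
    have e2 : (1 - l) * 0 + l * t = b := by linarith
    have e3 : (1 - l) * α + l * (2 * t) = a' + b := by linarith
    rw [e1] at s1
    rw [e2, Real.cos_zero] at s2
    rw [e3] at s3
    have := mul_lt_mul_of_pos_left hlt hl0
    linarith

/-- Symmetric form of `gap_pair_of_le`: two consecutive gaps bounded by `m` have sum at least
`(n α - m) / (n - 1)`, with equality only for the pairs `(α, 0)` and `(0, α)`. -/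
lemma gap_pair {n : ℕ} (hn : 5 ≤ n) {α a b m : ℝ} (hα : n * α = 2 * Real.pi) (ha : 0 ≤ a)
    (hb : 0 ≤ b) (ham : a ≤ m) (hbm : b ≤ m)
    (hg : Real.cos a + Real.cos b + Real.cos (a + b) ≤ 1 + 2 * Real.cos α) :
    n * α ≤ (n - 1) * (a + b) + m ∧
      ((n - 1) * (a + b) + m = n * α → a = α ∧ b = 0 ∨ a = 0 ∧ b = α) := by
  have main : (n - 1) * (a + b) + m ≤ n * α → a = α ∧ b = 0 ∨ a = 0 ∧ b = α := by
    intro h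
    rcases le_total b a with hba | hab
    · exact Or.inl (gap_pair_of_le hn hα hb hba hg (by linarith))
    · have := gap_pair_of_le hn hα ha hab (by rw [add_comm b a]; linarith) (by linarith)
      exact Or.inr ⟨this.2, this.1⟩
  refine ⟨?_, fun h => main h.le⟩
  by_contra! hlt
  -- Each extremal pair contains α, so α ≤ m, against the strict inequality.
  rcases main hlt.le with ⟨rfl, rfl⟩ | ⟨rfl, rfl⟩ <;> linarith

/-! ### Rigidity of cyclic gap sequences. -/

/-- Grouping the terms of a sum of odd length after the first one into consecutive pairs. -/
lemma sum_range_odd_eq (f : ℕ → ℝ) (p : ℕ) :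
    ∑ k ∈ Finset.range (2 * p + 1), f k =
      f 0 + ∑ i ∈ Finset.range p, (f (2 * i + 1) + f (2 * i + 2)) := by
  induction p with
  | zero => simp
  | succ p ih =>
    rw [show 2 * (p + 1) + 1 = 2 * p + 1 + 1 + 1 by ring, Finset.sum_range_succ,
      Finset.sum_range_succ, ih, Finset.sum_range_succ]
    ring

/-- A periodic sequence of `2 n - 1` nonnegative gaps of total length `n α = 2 π`, starting at a
largest one: if consecutive pairs of gaps satisfy the cosine inequality, then the largest gap is `α`
and the remaining ones, grouped in pairs, are `α, 0` or `0, α`. -/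
lemma pairs_of_max {n : ℕ} (hn : 5 ≤ n) {α : ℝ} (hα : n * α = 2 * Real.pi) {d : ℕ → ℝ}
    (hd : ∀ k, 0 ≤ d k) (hmax : ∀ k, d k ≤ d 0)
    (hsum : ∑ k ∈ Finset.range (2 * (n - 1) + 1), d k = n * α)
    (hg : ∀ k, Real.cos (d k) + Real.cos (d (k + 1)) + Real.cos (d k + d (k + 1)) ≤
      1 + 2 * Real.cos α) :
    d 0 = α ∧ ∀ i < n - 1, d (2 * i + 1) = α ∧ d (2 * i + 2) = 0 ∨
      d (2 * i + 1) = 0 ∧ d (2 * i + 2) = α := by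
  have hpair := fun i => gap_pair hn hα (hd (2 * i + 1)) (hd (2 * i + 2)) (hmax _) (hmax _)
    (hg (2 * i + 1))
  have hn1 : ((n - 1 : ℕ) : ℝ) = n - 1 := by rw [Nat.cast_sub (by omega)]; simp
  have hn' : (5 : ℝ) ≤ n := by exact_mod_cast hn
  rw [sum_range_odd_eq] at hsum
  -- The slack of the i-th pair inequality: nonnegative, with total zero by `hsum`, hence zero for
  -- every pair.
  set f : ℕ → ℝ := fun i => (n - 1) * (d (2 * i + 1) + d (2 * i + 2)) + d 0 - n * α with hf
  have hf0 : ∀ i ∈ Finset.range (n - 1), 0 ≤ f i := fun i _ => by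
    have := (hpair i).1
    simp only [hf]; linarith
  have hfs : ∑ i ∈ Finset.range (n - 1), f i = 0 := by
    have : ∑ i ∈ Finset.range (n - 1), f i = (n - 1) * ∑ i ∈ Finset.range (n - 1),
        (d (2 * i + 1) + d (2 * i + 2)) + (n - 1) * (d 0 - n * α) := by
      rw [Finset.mul_sum, ← hn1, ← nsmul_eq_mul, ← nsmul_eq_mul]
      conv_rhs => rw [nsmul_eq_mul, ← Finset.card_range (n - 1), ← nsmul_eq_mul,
        ← Finset.sum_const, Finset.card_range, ← Finset.sum_add_distrib]
      refine Finset.sum_congr rfl fun i _ => ?_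
      simp only [hf, hn1]; ring
    rw [this, ← mul_add]
    have : ∑ i ∈ Finset.range (n - 1), (d (2 * i + 1) + d (2 * i + 2)) + (d 0 - n * α) = 0 := by
      linarith
    rw [this, mul_zero]
  have hfz := (Finset.sum_eq_zero_iff_of_nonneg hf0).1 hfs
  have hall : ∀ i < n - 1, d (2 * i + 1) = α ∧ d (2 * i + 2) = 0 ∨
      d (2 * i + 1) = 0 ∧ d (2 * i + 2) = α := fun i hi => by
    have := hfz i (Finset.mem_range.2 hi)
    exact (hpair i).2 (by simp only [hf] at this; linarith)
  refine ⟨?_, hall⟩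
  have h0 := hfz 0 (Finset.mem_range.2 (by omega))
  simp only [hf] at h0
  rcases hall 0 (by omega) with ⟨h, h'⟩ | ⟨h, h'⟩ <;> rw [h, h'] at h0 <;> linarith

/-- A periodic sequence with odd period and values in `{0, α}` has two equal consecutive terms. -/
lemma exists_consecutive_eq {n : ℕ} {α : ℝ} (hα : α ≠ 0) {d : ℕ → ℝ}
    (hper : ∀ k, d (k + (2 * n + 1)) = d k) (h : ∀ k, d k = α ∨ d k = 0) :
    ∃ k, d k = d (k + 1) := by
  by_contra! hne
  have hstep : ∀ k, d (k + 1) = α - d k := by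
    intro k
    have := hne k
    rcases h k with h1 | h1 <;> rcases h (k + 1) with h2 | h2 <;> rw [h1, h2] at this ⊢ <;> simp_all
  have heven : ∀ i k, d (k + 2 * i) = d k := by
    intro i
    induction i with
    | zero => simp
    | succ i ih =>
      intro k
      rw [show k + 2 * (i + 1) = k + 2 * i + 1 + 1 by ring, hstep, hstep, ih]
      ring
  have := hstep (0 + 2 * n)
  rw [heven] at this
  have h0 := hper 0
  rw [zero_add] at h0
  rw [show 0 + 2 * n + 1 = 2 * n + 1 by ring, h0] at this
  rcases h 0 with h1 | h1 <;> rw [h1] at this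
  · exact hα (by linarith)
  · exact hα (by linarith)

/-- A periodic sequence of `2 n - 1` nonnegative gaps of total length `2 π` all of whose consecutive
pairs satisfy the cosine inequality is the alternating one. -/
lemma alternating_of_gaps {n : ℕ} (hn : 5 ≤ n) {α : ℝ} (hα : n * α = 2 * Real.pi) {d : ℕ → ℝ}
    (hper : ∀ k, d (k + (2 * (n - 1) + 1)) = d k) (hd : ∀ k, 0 ≤ d k)
    (hsum : ∀ j, ∑ k ∈ Finset.range (2 * (n - 1) + 1), d (j + k) = n * α)
    (hg : ∀ k, Real.cos (d k) + Real.cos (d (k + 1)) + Real.cos (d k + d (k + 1)) ≤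
      1 + 2 * Real.cos α) :
    ∃ j, ∀ k < 2 * (n - 1) + 1, d (j + k) = if Even k then α else 0 := by
  set p := n - 1 with hp
  have hα0 : 0 < α := by
    by_contra! h
    have : (n : ℝ) * α ≤ 0 := mul_nonpos_of_nonneg_of_nonpos (by positivity) h
    linarith [Real.pi_pos]
  have hα1 : α < Real.pi := by
    have : (5 : ℝ) ≤ n := by exact_mod_cast hn
    nlinarith [Real.pi_pos]
  have hperm : ∀ i k, d (k + (2 * p + 1) * i) = d k := by
    intro i
    induction i with
    | zero => simp
    | succ i ih => intro k; rw [mul_add, mul_one, ← add_assoc, hper, ih]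
  have hmod : ∀ k, d (k % (2 * p + 1)) = d k := fun k => by
    conv_rhs => rw [← Nat.mod_add_div k (2 * p + 1)]
    rw [hperm]
  have hpairs : ∀ j, (∀ k, d k ≤ d j) → d j = α ∧ ∀ i < p, d (j + (2 * i + 1)) = α ∧
      d (j + (2 * i + 2)) = 0 ∨ d (j + (2 * i + 1)) = 0 ∧ d (j + (2 * i + 2)) = α := fun j hj =>
    pairs_of_max hn hα (d := fun k => d (j + k)) (fun _ => hd _) (fun _ => hj _) (hsum j)
      (fun k => hg (j + k))
  obtain ⟨j, -, hj⟩ := Finset.exists_max_image (Finset.range (2 * p + 1)) d ⟨0, by simp⟩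
  have hj' : ∀ k, d k ≤ d j := fun k => by
    rw [← hmod k]
    exact hj _ (Finset.mem_range.2 (Nat.mod_lt _ (by omega)))
  obtain ⟨hjα, hjp⟩ := hpairs j hj'
  have hval0 : ∀ k < 2 * p + 1, d (j + k) = α ∨ d (j + k) = 0 := by
    intro k hk
    rcases Nat.even_or_odd' k with ⟨i, rfl | rfl⟩
    · rcases i with _ | i
      · exact Or.inl hjα
      · have := hjp i (by omega)
        rw [show 2 * (i + 1) = 2 * i + 2 by ring]
        tauto
    · have := hjp i (by omega)
      tauto
  have hval : ∀ k, d k = α ∨ d k = 0 := by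
    intro k
    have h1 : j ≤ k + (2 * p + 1) * j := by nlinarith
    obtain ⟨l, hl⟩ := Nat.exists_eq_add_of_le h1
    have h2 := hval0 (l % (2 * p + 1)) (Nat.mod_lt _ (by omega))
    rwa [← hperm (l / (2 * p + 1)), add_assoc, Nat.mod_add_div, ← hl, hperm] at h2
  have hnz : ∀ k, ¬ (d k = 0 ∧ d (k + 1) = 0) := by
    rintro k ⟨h0, h1⟩
    have := hg k
    rw [h0, h1, add_zero, Real.cos_zero] at this
    have h2 : Real.cos α < Real.cos 0 :=
      Real.cos_lt_cos_of_nonneg_of_le_pi le_rfl hα1.le hα0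
    rw [Real.cos_zero] at h2
    linarith
  -- Two adjacent gaps are equal by parity, and both are α since two zeros would put three points
  -- together. The pattern starts at the second of them, so its last gap is the first.
  obtain ⟨k, hk⟩ := exists_consecutive_eq hα0.ne' hper hval
  have hkα : d k = α ∧ d (k + 1) = α := by
    have := hnz k
    rcases hval k with h | h
    · exact ⟨h, by rw [← hk, h]⟩
    · exact absurd ⟨h, by rw [← hk, h]⟩ this
  refine ⟨k + 1, ?_⟩
  obtain ⟨hkα', hkp⟩ := hpairs (k + 1) (fun i => by
    rcases hval i with h | h <;> rw [h, hkα.2]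
    exact hα0.le)
  -- Induction backwards from the last pair, which must end in α; a pair (α, 0) before a pair (0, α)
  -- would create two adjacent zeros.
  have hback : ∀ i < p, d (k + 1 + (2 * (p - 1 - i) + 1)) = 0 ∧
      d (k + 1 + (2 * (p - 1 - i) + 2)) = α := by
    intro i
    induction i with
    | zero =>
      intro hi
      have h1 : d (k + 1 + (2 * (p - 1 - 0) + 2)) = α := by
        rw [show k + 1 + (2 * (p - 1 - 0) + 2) = k + (2 * p + 1) by omega, hper, hkα.1]
      rcases hkp (p - 1 - 0) (by omega) with h | h
      · rw [h1] at h
        exact absurd h.2 hα0.ne'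
      · exact h
    | succ i ih =>
      intro hi
      have h1 := (ih (by omega)).1
      rcases hkp (p - 1 - (i + 1)) (by omega) with h | h
      · refine absurd ⟨h.2, ?_⟩ (hnz _)
        rwa [show k + 1 + (2 * (p - 1 - (i + 1)) + 2) + 1 = k + 1 + (2 * (p - 1 - i) + 1) by omega]
      · exact h
  intro l hl
  rcases Nat.even_or_odd' l with ⟨i, rfl | rfl⟩
  · rw [if_pos (by simp)]
    rcases i with _ | i
    · exact hkα.2
    · have := (hback (p - 1 - i) (by omega)).2
      rwa [show p - 1 - (p - 1 - i) = i by omega] at this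
  · rw [if_neg (by simp)]
    have := (hback (p - 1 - i) (by omega)).1
    rwa [show p - 1 - (p - 1 - i) = i by omega] at this

/-! ### Arcs as differences of a lifted sequence. -/

lemma arc_nonneg {N : ℕ} (θ : Fin N → ℝ) (hθ : ∀ i, θ i ∈ Set.Ico 0 Real.pi) (i : Fin N) :
    0 ≤ arc θ i := by
  rw [arc]
  split_ifs with h
  · have h1 := (hθ (Tuple.sort θ (finRotate N i))).1
    have h2 := (hθ (Tuple.sort θ i)).2
    simp only [sortedDoubled]
    linarith
  · have hle : i ≤ finRotate N i := by
      have hi := i.2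
      rw [finRotate_apply, Fin.le_def, Fin.val_add, Fin.val_one', Nat.add_mod_mod,
        Nat.mod_eq_of_lt (by omega)]
      omega
    have := Tuple.monotone_sort θ hle
    simp only [Function.comp_apply] at this
    simp only [sortedDoubled]
    linarith

section Sequence

variable {N : ℕ} [NeZero N]

/-- The sorted doubled angles continued to a sequence with `u (k + N) = u k + 2 π`. -/
noncomputable def liftedSequence (θ : Fin N → ℝ) (k : ℕ) : ℝ :=
  sortedDoubled θ (Fin.ofNat N k) + 2 * Real.pi * (k / N : ℕ)

/-- The index of the angle at position `k` in the cyclic order. -/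
noncomputable def cyclicIndex (θ : Fin N → ℝ) (k : ℕ) : Fin N :=
  Tuple.sort θ (Fin.ofNat N k)

lemma liftedSequence_eq (θ : Fin N → ℝ) (k : ℕ) :
    liftedSequence θ k = 2 * θ (cyclicIndex θ k) + 2 * Real.pi * (k / N : ℕ) := rfl

lemma liftedSequence_add_period (θ : Fin N → ℝ) (k : ℕ) :
    liftedSequence θ (k + N) = liftedSequence θ k + 2 * Real.pi := by
  have hN : 0 < N := Nat.pos_of_neZero N
  have : Fin.ofNat N (k + N) = Fin.ofNat N k := by
    ext; simp
  rw [liftedSequence, liftedSequence, this, Nat.add_div_right _ hN]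
  push_cast
  ring

/-- The 2π in the last arc matches the jump of `k / N` when `N ∣ k + 1`. Sums of arcs therefore
telescope across the wrap-around. -/
lemma arc_ofNat (θ : Fin N → ℝ) (k : ℕ) :
    arc θ (Fin.ofNat N k) = liftedSequence θ (k + 1) - liftedSequence θ k := by
  have hN : 0 < N := Nat.pos_of_neZero N
  have h1 : finRotate N (Fin.ofNat N k) = Fin.ofNat N (k + 1) := by
    rw [finRotate_apply]
    ext
    simp [Fin.val_add]
  rw [arc, h1, liftedSequence, liftedSequence, Fin.val_ofNat, Nat.succ_div]
  have h2 : N ∣ k + 1 ↔ k % N + 1 = N := by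
    have := Nat.mod_lt k hN
    rw [Nat.dvd_iff_mod_eq_zero, Nat.add_mod]
    constructor
    · intro h
      by_contra hne
      have h3 : N ≠ 1 := by rintro rfl; omega
      rw [Nat.mod_eq_of_lt (a := 1) (by omega), Nat.mod_eq_of_lt (by omega)] at h
      omega
    · intro h
      rw [← Nat.add_mod, ← Nat.mod_add_mod, h, Nat.mod_self]
  simp only [h2]
  split_ifs
  · push_cast; ring
  · simp

lemma cos_liftedSequence_sub (θ : Fin N → ℝ) (k l : ℕ) :
    Real.cos (2 * θ (cyclicIndex θ k) - 2 * θ (cyclicIndex θ l)) =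
      Real.cos (liftedSequence θ k - liftedSequence θ l) := by
  rw [liftedSequence_eq, liftedSequence_eq,
    show 2 * θ (cyclicIndex θ k) + 2 * Real.pi * (k / N : ℕ) -
      (2 * θ (cyclicIndex θ l) + 2 * Real.pi * (l / N : ℕ)) =
      2 * θ (cyclicIndex θ k) - 2 * θ (cyclicIndex θ l) +
        (((k / N : ℕ) - (l / N : ℕ) : ℤ) : ℝ) * (2 * Real.pi) by
          simp only [Int.cast_sub, Int.cast_natCast]; ring,
    Real.cos_add_int_mul_two_pi]

lemma cyclicIndex_inj (θ : Fin N → ℝ) {k l : ℕ} :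
    cyclicIndex θ k = cyclicIndex θ l ↔ k % N = l % N := by
  rw [cyclicIndex, cyclicIndex, EmbeddingLike.apply_eq_iff_eq, Fin.ext_iff, Fin.val_ofNat,
    Fin.val_ofNat]

lemma cyclicIndex_add_ne (θ : Fin N → ℝ) (k : ℕ) {i j : ℕ} (hij : i < j) (hj : j < N) :
    cyclicIndex θ (k + i) ≠ cyclicIndex θ (k + j) := by
  rw [Ne, cyclicIndex_inj]
  intro h
  have := Nat.ModEq.add_left_cancel' k h
  rw [Nat.ModEq, Nat.mod_eq_of_lt (by omega), Nat.mod_eq_of_lt hj] at this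
  omega

lemma tripleCos_consecutive (θ : Fin N → ℝ) (k : ℕ) :
    tripleCos θ (cyclicIndex θ k) (cyclicIndex θ (k + 1)) (cyclicIndex θ (k + 2)) =
      Real.cos (arc θ (Fin.ofNat N k)) + Real.cos (arc θ (Fin.ofNat N (k + 1))) +
        Real.cos (arc θ (Fin.ofNat N k) + arc θ (Fin.ofNat N (k + 1))) := by
  rw [tripleCos, cos_liftedSequence_sub, cos_liftedSequence_sub, cos_liftedSequence_sub,
    arc_ofNat, arc_ofNat]
  congr 1
  · congr 1 <;> rw [← Real.cos_neg, neg_sub]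
  · rw [← Real.cos_neg]
    congr 1
    ring

lemma arcsAlternate_iff (θ : Fin N → ℝ) (α β : ℝ) :
    ArcsAlternate θ α β ↔
      ∃ j : ℕ, ∀ k < N, arc θ (Fin.ofNat N (j + k)) = if Even k then α else β := by
  have key : ∀ j k : ℕ, Fin.ofNat N (j + k) = Fin.ofNat N j + Fin.ofNat N k := by
    intro j k
    ext
    simp [Fin.val_add]
  constructor
  · rintro ⟨j, hj⟩
    refine ⟨j, fun k hk => ?_⟩
    have := hj ⟨k, hk⟩
    rw [key, show Fin.ofNat N j = j by simp, show Fin.ofNat N k = ⟨k, hk⟩ by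
      ext; simp [Nat.mod_eq_of_lt hk]]
    exact this
  · rintro ⟨j, hj⟩
    refine ⟨Fin.ofNat N j, fun k => ?_⟩
    rw [← hj k k.2, key, show Fin.ofNat N (k : ℕ) = k by simp]

/-- Only even steps advance by α, and `(k + 1) / 2` counts the even numbers below `k`. -/
lemma liftedSequence_of_alternating (θ : Fin N → ℝ) {α : ℝ} {j : ℕ}
    (hj : ∀ k < N, arc θ (Fin.ofNat N (j + k)) = if Even k then α else 0) :
    ∀ k ≤ N, liftedSequence θ (j + k) = liftedSequence θ j + α * ((k + 1) / 2 : ℕ) := by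
  intro k
  induction k with
  | zero => simp
  | succ k ih =>
    intro hk
    have h1 := hj k (by omega)
    rw [arc_ofNat, ih (by omega), sub_eq_iff_eq_add] at h1
    rw [← add_assoc, h1]
    rcases Nat.even_or_odd' k with ⟨i, rfl | rfl⟩
    · rw [if_pos (by simp), show (2 * i + 1) / 2 = i by omega,
        show (2 * i + 1 + 1) / 2 = i + 1 by omega]
      push_cast; ring
    · rw [if_neg (by simp), show (2 * i + 1 + 1) / 2 = i + 1 by omega,
        show (2 * i + 1 + 1 + 1) / 2 = i + 1 by omega]
      ring

lemma exists_eq_cyclicIndex_add (θ : Fin N → ℝ) (j : ℕ) (i : Fin N) :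
    ∃ k < N, i = cyclicIndex θ (j + k) := by
  have hN : 0 < N := Nat.pos_of_neZero N
  obtain ⟨l, rfl⟩ := (Tuple.sort θ).surjective i
  refine ⟨(l + (N - j % N)) % N, Nat.mod_lt _ hN, ?_⟩
  rw [cyclicIndex]
  congr 1
  ext
  have := Nat.mod_lt j hN
  rw [Fin.val_ofNat, Nat.add_mod_mod, ← Nat.mod_add_mod,
    show j % N + (l + (N - j % N)) = l + N by omega, Nat.add_mod_right, Nat.mod_eq_of_lt l.2]

end Sequence

/-! ### Regular polygons and the extremal configurations. -/

/-- Angles supported on the vertices of a regular `n`-gon, at most two at each vertex, form triples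
with small cosine sums. -/
lemma triplesLE_of_lattice {N n : ℕ} (hn : 2 ≤ n) {α φ : ℝ} (hα : n * α = 2 * Real.pi)
    (θ : Fin N → ℝ) (w : Fin N → ℕ) (z : Fin N → ℤ) (hw : ∀ i, w i < n)
    (hwθ : ∀ i, 2 * θ i = φ + α * w i + z i * (2 * Real.pi))
    (hw3 : ∀ i j k, i ≠ j → i ≠ k → j ≠ k → w i = w j → w j ≠ w k) :
    TriplesLE θ (1 + 2 * Real.cos α) := by
  have hn0 : (2 : ℝ) ≤ n := by exact_mod_cast hn
  have hpi := Real.pi_pos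
  have hα0 : 0 < α := by
    by_contra! h
    have : (n : ℝ) * α ≤ 0 := mul_nonpos_of_nonneg_of_nonpos (by positivity) h
    linarith
  have hdist : ∀ i j, w i < w j → Real.cos (2 * θ i - 2 * θ j) ≤ Real.cos α := by
    intro i j hij
    have e : 2 * θ i - 2 * θ j = -(α * (w j - w i)) + ((z i - z j : ℤ) : ℝ) * (2 * Real.pi) := by
      rw [hwθ, hwθ]; push_cast; ring
    rw [e, Real.cos_add_int_mul_two_pi, Real.cos_neg]
    have h1 : (1 : ℝ) ≤ w j - w i := by
      have : (w i : ℝ) + 1 ≤ w j := by exact_mod_cast hij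
      linarith
    -- This bounds the complementary arc below by α, for pairs more than π apart.
    have h2 : (w j : ℝ) - w i ≤ n - 1 := by
      have : (w j : ℝ) + 1 ≤ n := by exact_mod_cast hw j
      have : (0 : ℝ) ≤ w i := Nat.cast_nonneg _
      linarith
    rcases le_total (α * (w j - w i)) Real.pi with h | h
    · exact Real.cos_le_cos_of_nonneg_of_le_pi hα0.le h (by nlinarith)
    · rw [← Real.cos_two_pi_sub]
      exact Real.cos_le_cos_of_nonneg_of_le_pi hα0.le (by linarith) (by nlinarith)
  have hne : ∀ i j, w i ≠ w j → Real.cos (2 * θ i - 2 * θ j) ≤ Real.cos α := by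
    intro i j hij
    rcases lt_or_gt_of_ne hij with h | h
    · exact hdist i j h
    · rw [← Real.cos_neg, neg_sub]
      exact hdist j i h
  intro i j k hij hik hjk
  have h3 := hw3 i j k hij hik hjk
  rw [tripleCos]
  by_cases h1 : w i = w j
  · have := hne j k (h3 h1)
    have := hne i k (h1 ▸ h3 h1)
    linarith [Real.cos_le_one (2 * θ i - 2 * θ j)]
  · have := hne i j h1
    by_cases h2 : w j = w k
    · have := hne i k (h2 ▸ h1)
      linarith [Real.cos_le_one (2 * θ j - 2 * θ k)]
    · have := hne j k h2
      linarith [Real.cos_le_one (2 * θ i - 2 * θ k)]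

variable {N n : ℕ} {α : ℝ}

lemma ArcsAlternate.triplesLE (hn : 5 ≤ n) (hN : N = 2 * (n - 1) + 1)
    (hα : n * α = 2 * Real.pi) {θ : Fin N → ℝ} (h : ArcsAlternate θ α 0) :
    TriplesLE θ (1 + 2 * Real.cos α) := by
  have : NeZero N := ⟨by omega⟩
  obtain ⟨j, hj⟩ := (arcsAlternate_iff θ α 0).1 h
  choose κ hκ hκi using exists_eq_cyclicIndex_add θ j
  have hinj : Function.Injective κ := fun a b hab => by rw [hκi a, hκi b, hab]
  -- The starting point is alone at vertex 0; positions 2i - 1 and 2i share vertex i, for i up to n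
  -- - 1.
  refine triplesLE_of_lattice (n := n) (by omega) hα (φ := liftedSequence θ j) θ
    (fun i => (κ i + 1) / 2) (fun i => -((j + κ i) / N : ℕ)) (fun i => ?_) (fun i => ?_) ?_
  · have := hκ i
    omega
  · have h1 := liftedSequence_of_alternating θ hj (κ i) (hκ i).le
    rw [liftedSequence_eq, ← hκi i] at h1
    rw [← h1]
    simp only [Int.cast_neg, Int.cast_natCast]
    ring
  · intro a b c hab hac hbc h1 h2
    have := hinj.ne hab
    have := hinj.ne hac
    have := hinj.ne hbc
    omega

lemma ArcsAlternate.exists_tripleCos_eq (hN : 3 ≤ N) {θ : Fin N → ℝ}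
    (h : ArcsAlternate θ α 0) : ∃ a b c, a ≠ b ∧ a ≠ c ∧ b ≠ c ∧
      tripleCos θ a b c = 1 + 2 * Real.cos α := by
  have : NeZero N := ⟨by omega⟩
  obtain ⟨j, hj⟩ := (arcsAlternate_iff θ α 0).1 h
  refine ⟨cyclicIndex θ j, cyclicIndex θ (j + 1), cyclicIndex θ (j + 2),
    cyclicIndex_add_ne θ j (i := 0) zero_lt_one (by omega),
    cyclicIndex_add_ne θ j (i := 0) zero_lt_two (by omega),
    cyclicIndex_add_ne θ j one_lt_two (by omega), ?_⟩
  rw [tripleCos_consecutive, hj 1 (by omega), if_neg (by simp)]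
  have h0 := hj 0 (by omega)
  rw [add_zero, if_pos (by simp)] at h0
  rw [h0, add_zero, Real.cos_zero]
  ring

lemma TriplesLE.arcsAlternate (hn : 5 ≤ n) (hN : N = 2 * (n - 1) + 1)
    (hα : n * α = 2 * Real.pi) {θ : Fin N → ℝ} (hθ : ∀ i, θ i ∈ Set.Ico 0 Real.pi)
    (h : TriplesLE θ (1 + 2 * Real.cos α)) : ArcsAlternate θ α 0 := by
  have : NeZero N := ⟨by omega⟩
  rw [arcsAlternate_iff]
  have := alternating_of_gaps hn hα (d := fun k => arc θ (Fin.ofNat N k)) (fun k => ?_)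
    (fun k => arc_nonneg θ hθ _) (fun j => ?_) (fun k => ?_)
  · rwa [← hN] at this
  · simp only [← hN]
    congr 1
    ext
    simp
  · simp only [arc_ofNat, ← hN]
    simp only [add_assoc]
    rw [Finset.sum_range_sub (fun k => liftedSequence θ (j + k)), liftedSequence_add_period, hα]
    ring_nf
  · rw [← tripleCos_consecutive]
    exact h _ _ _ (cyclicIndex_add_ne θ k (i := 0) zero_lt_one (by omega))
      (cyclicIndex_add_ne θ k (i := 0) zero_lt_two (by omega))
      (cyclicIndex_add_ne θ k one_lt_two (by omega))

/-- Every choice of angles has a triple with cosine sum at least the extremal value. -/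
lemma exists_le_tripleCos (hn : 5 ≤ n) (hN : N = 2 * (n - 1) + 1) (hα : n * α = 2 * Real.pi)
    (θ : Fin N → ℝ) : ∃ a b c, a ≠ b ∧ a ≠ c ∧ b ≠ c ∧
      1 + 2 * Real.cos α ≤ tripleCos θ a b c := by
  -- Reduction modulo π moves doubled angles by multiples of 2π, so cosine sums are unchanged and
  -- the rigidity result for angles in [0, π) applies.
  set θ' : Fin N → ℝ := fun i => toIcoMod Real.pi_pos 0 (θ i) with hθ'
  have hmem : ∀ i, θ' i ∈ Set.Ico 0 Real.pi := fun i => by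
    simpa using toIcoMod_mem_Ico Real.pi_pos 0 (θ i)
  have hcos : ∀ i j, Real.cos (2 * θ' i - 2 * θ' j) = Real.cos (2 * θ i - 2 * θ j) := by
    intro i j
    have e : 2 * θ i - 2 * θ j = 2 * θ' i - 2 * θ' j +
        ((toIcoDiv Real.pi_pos 0 (θ i) - toIcoDiv Real.pi_pos 0 (θ j) : ℤ) : ℝ) *
          (2 * Real.pi) := by
      simp only [hθ', toIcoMod, zsmul_eq_mul]
      push_cast
      ring
    rw [e, Real.cos_add_int_mul_two_pi]
  have htriple : ∀ a b c, tripleCos θ' a b c = tripleCos θ a b c := fun a b c => by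
    simp only [tripleCos, hcos]
  by_contra! hlt
  have hle : TriplesLE θ' (1 + 2 * Real.cos α) := fun a b c hab hac hbc => by
    rw [htriple]
    exact (hlt a b c hab hac hbc).le
  obtain ⟨a, b, c, hab, hac, hbc, heq⟩ :=
    (hle.arcsAlternate hn hN hα hmem).exists_tripleCos_eq (by omega)
  have := hlt a b c hab hac hbc
  rw [← htriple, heq] at this
  exact lt_irrefl _ this

lemma triplesLE_optimalAngles (hn : 5 ≤ n) (hN : N = 2 * (n - 1) + 1)
    (hα : n * α = 2 * Real.pi) : TriplesLE (optimalAngles N) (1 + 2 * Real.cos α) := by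
  have hNn : (N : ℝ) + 1 = 2 * n := by
    have : N + 1 = 2 * n := by omega
    exact_mod_cast this
  have hn0 : (n : ℝ) ≠ 0 := by
    have : n ≠ 0 := by omega
    exact_mod_cast this
  -- Modulo 2π the i-th doubled angle is iα, hence vertex `i % n`; as i < 2n - 1, each residue
  -- occurs at most twice.
  refine triplesLE_of_lattice (n := n) (by omega) hα (φ := 0) _ (fun i => i % n)
    (fun i => (i / n : ℕ) -
      toIcoDiv Real.pi_pos 0 (2 * Real.pi * ((i : ℕ) : ℝ) / ((N : ℝ) + 1)))
    (fun i => Nat.mod_lt _ (by omega)) (fun i => ?_) ?_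
  · have h1 : ((i : ℕ) : ℝ) = (i % n : ℕ) + n * (i / n : ℕ) := by
      exact_mod_cast (Nat.mod_add_div (i : ℕ) n).symm
    have h2 : 2 * (2 * Real.pi * ((i : ℕ) : ℝ) / ((N : ℝ) + 1)) =
        α * (i % n : ℕ) + (i / n : ℕ) * (2 * Real.pi) := by
      rw [hNn, ← hα]
      nth_rewrite 1 [h1]
      field_simp
    simp only [optimalAngles, toIcoMod, zsmul_eq_mul]
    rw [mul_sub, h2]
    simp only [Int.cast_sub, Int.cast_natCast]
    ring
  · intro a b c hab hac hbc h1 h2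
    have ha := a.2
    have hb := b.2
    have hc := c.2
    have hab' := Fin.val_ne_of_ne hab
    have hac' := Fin.val_ne_of_ne hac
    have hbc' := Fin.val_ne_of_ne hbc
    have hdiv : ∀ x : Fin N, (x : ℕ) / n = 0 ∨ (x : ℕ) / n = 1 := fun x => by
      have : (x : ℕ) / n < 2 := by
        have := x.2
        exact Nat.div_lt_of_lt_mul (by omega)
      exact Nat.le_one_iff_eq_zero_or_eq_one.1 (Nat.lt_succ_iff.1 this)
    have ea := Nat.mod_add_div (a : ℕ) n
    have eb := Nat.mod_add_div (b : ℕ) n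
    have ec := Nat.mod_add_div (c : ℕ) n
    rcases hdiv a with h | h <;> rcases hdiv b with h' | h' <;> rcases hdiv c with h'' | h'' <;>
      rw [h] at ea <;> rw [h'] at eb <;> rw [h''] at ec <;> omega

/-- A matrix of unit columns in the plane is optimal exactly when no triple exceeds the extremal
value. -/
lemma isOptimalMatrix_iff (hn : 5 ≤ n) (hN : N = 2 * (n - 1) + 1) (hα : n * α = 2 * Real.pi)
    (θ : Fin N → ℝ) :
    IsOptimalMatrix 3 (angleMatrix θ) ↔ TriplesLE θ (1 + 2 * Real.cos α) := by
  have hn0 : (5 : ℝ) ≤ n := by exact_mod_cast hn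
  have hpi := Real.pi_pos
  have hα0 : 0 < α := by
    by_contra! h
    have : (n : ℝ) * α ≤ 0 := mul_nonpos_of_nonneg_of_nonpos (by positivity) h
    linarith
  have hα1 : α ≤ 2 * Real.pi / 5 := by nlinarith
  have hcos : Real.cos α < 1 := by
    rw [← Real.cos_zero]
    exact Real.cos_lt_cos_of_nonneg_of_le_pi le_rfl (by linarith) hα0
  have hcos0 : 0 ≤ Real.cos α :=
    Real.cos_nonneg_of_neg_pi_div_two_le_of_le (by linarith) (by linarith)
  have hiff := fun θ' : Fin N → ℝ => maxCondNumber_le_iff θ' (c := 1 + 2 * Real.cos α)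
    (by linarith) (by linarith)
  rw [← hiff]
  constructor
  · intro h
    exact (h.2 _ (unitColumns_angleMatrix (optimalAngles N))).trans
      ((hiff _).2 (triplesLE_optimalAngles hn hN hα))
  · intro h
    refine ⟨unitColumns_angleMatrix θ, fun B hB => h.trans ?_⟩
    obtain ⟨θ', rfl⟩ := hB.exists_eq_angleMatrix
    obtain ⟨a, b, c, hab, hac, hbc, hle⟩ := exists_le_tripleCos hn hN hα θ'
    exact (tripleCond_mono hle).trans (tripleCond_le_maxCondNumber θ' hab hac hbc)

end Sensing

theorem theorem6 (N : ℕ) (hN : 9 ≤ N) (hodd : Odd N) :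
    Sensing.IsOptimalMatrix 3 (Sensing.angleMatrix (Sensing.optimalAngles N)) ∧
    ∀ θ : Fin N → ℝ, (∀ i, θ i ∈ Set.Ico 0 Real.pi) →
      (Sensing.IsOptimalMatrix 3 (Sensing.angleMatrix θ) ↔
        Sensing.ArcsAlternate θ (4 * Real.pi / ((N : ℝ) + 1)) 0) := by
  obtain ⟨p, rfl⟩ := hodd
  have hn : 5 ≤ p + 1 := by omega
  have hN' : 2 * p + 1 = 2 * (p + 1 - 1) + 1 := by omega
  have hα : ((p + 1 : ℕ) : ℝ) * (4 * Real.pi / (((2 * p + 1 : ℕ) : ℝ) + 1)) = 2 * Real.pi := by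
    push_cast
    field_simp
    ring
  refine ⟨(Sensing.isOptimalMatrix_iff hn hN' hα _).2 (Sensing.triplesLE_optimalAngles hn hN' hα),
    fun θ hθ => ?_⟩
  rw [Sensing.isOptimalMatrix_iff hn hN' hα]
  exact ⟨fun h => h.arcsAlternate hn hN' hα hθ, fun h => h.triplesLE hn hN' hα⟩
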